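/- **Setting.** Consider a static discrete game of complete information with finitely many players $i$, finite action sets $\mathcal Y_i$, outcome set $\mathcal Y=\prod_i\mathcal Y_i$, a finite set $\mathcal X$ of covariate values, player-specific latent shocks $\varepsilon=(\varepsilon_i)_i\in\mathcal E=\prod_i\mathcal E_i$, parameter space $\Theta\subseteq\mathbb R^d$, and payoffs $u_i(y,x,\varepsilon_i;\theta)$. For $x\in\mathcal X$ and $\theta\in\Theta$ let $\nu(\cdot\mid x;\theta)$ be the probability law of $\varepsilon$, let $G(\varepsilon\mid x;\theta)\subseteq\mathcal Y$ be the set of pure strategy Nash equilibria, and assume that $\{\varepsilon: y\in G(\varepsilon\mid x;\theta)\}$ is measurable for every $y\in\mathcal Y$. For $A\subseteq\mathcal Y$ put $$G^{-1}(A\mid x;\theta)=\{\varepsilon: G(\varepsilon\mid x;\theta)\cap A\neq\emptyset\},\qquad \mathcal L(A\mid x;\theta)=\nu\big(G^{-1}(A\mid x;\theta)\mid x;\theta\big).$$ Let $\phi(\cdot\mid x)$ be a probability vector on $\mathcal Y$ for each $x\in\mathcal X$ (the conditional choice probabilities), and write $\phi(A\mid x)=\sum_{y\in A}\phi(y\mid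 x)$. The sharp identified set $\Theta_I^{sharp}$ is the set of $\theta\in\Theta$ such that for every $x\in\mathcal X$ there is a measurable equilibrium selection rule $\varepsilon\mapsto\sigma(\cdot\mid\varepsilon)$, that is, a family of probability vectors on $\mathcal Y$ with $\sigma(\cdot\mid\varepsilon)$ supported in $G(\varepsilon\mid x;\theta)$ for $\nu(\cdot\mid x;\theta)$-almost every $\varepsilon$, with $\phi(y\mid x)=\int\sigma(y\mid\varepsilon)\,d\nu(\varepsilon\mid x;\theta)$ for all $y\in\mathcal Y$. Let $\mathcal A^*_{x,\theta}$ be the class of all $A\subseteq\mathcal Y$ that can **not** be written as $A=B^1\cup B^2$ with $B^1,B^2$ nonempty and disjoint and $G^{-1}(B^1\mid x;\theta)\cap G^{-1}(B^2\mid x;\theta)=\emptyset$. **Theorem.** $$\Theta_I^{sharp}=\big\{\theta\in\Theta:\ \phi(A\mid x)\le\mathcal L(A\mid x;\theta)\ \text{ for all } x\in\mathcal X \text{ and all } A\in\mathcal A^*_{x,\theta}\big\}.$$ Moreover, for all $x\in\mathcal X$ and $\theta\in\Theta$ the class $\mathcal A^*_{x,\theta}$ is core-determining: every probability vector $p$ on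 $\mathcal Y$ with $\sum_{y\in A}p(y)\le\mathcal L(A\mid x;\theta)$ for all $A\in\mathcal A^*_{x,\theta}$ satisfies this inequality for all $A\subseteq\mathcal Y$. -/

import Mathlib

open MeasureTheory

/-- A static discrete game of complete information with players `ι`, action sets `Act i`,
covariates `X`, player-specific latent shocks in `E i`, and structural parameters in `ℝᵈ`.
Player `i`'s payoff depends on the latent vector only through `i`'s own shock. The latent vector
`ε = (εᵢ)ᵢ` has law `shockLaw x θ`, under which the `εᵢ` may be dependent. -/
structure DiscreteGame (ι : Type*) (Act : ι → Type*) (X : Type*) (E : ι → Type*)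
    [∀ i, MeasurableSpace (E i)] (d : ℕ) where
  /-- The parameter space. -/
  paramSpace : Set (EuclideanSpace ℝ (Fin d))
  /-- `payoff i y x e θ` is player `i`'s payoff at action profile `y`, covariate `x`, own
  shock `e` and parameter `θ`. -/
  payoff : (i : ι) → (∀ j, Act j) → X → E i → EuclideanSpace ℝ (Fin d) → ℝ
  /-- The law of the latent vector given `x` at parameter `θ`. -/
  shockLaw : X → EuclideanSpace ℝ (Fin d) → Measure (∀ i, E i)

/-- A class `𝒜` of subsets of the finite set `Y` is core-determining for the set function `L` if
every probability vector `p` on `Y` with `p(A) ≤ L(A)` for all `A ∈ 𝒜` lies in the core of `L`,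
that is, satisfies `p(A) ≤ L(A)` for all `A ⊆ Y`. -/
def IsCoreDetermining {Y : Type*} [Fintype Y] (L : Finset Y → ℝ) (𝒜 : Set (Finset Y)) : Prop :=
  ∀ p ∈ stdSimplex ℝ Y, (∀ A ∈ 𝒜, ∑ y ∈ A, p y ≤ L A) → ∀ A : Finset Y, ∑ y ∈ A, p y ≤ L A

namespace DiscreteGame

section

variable {ι : Type*} [Fintype ι] [DecidableEq ι]
  {Act : ι → Type*} [∀ i, Fintype (Act i)] [∀ i, DecidableEq (Act i)]
  {X : Type*} {E : ι → Type*} [∀ i, MeasurableSpace (E i)] {d : ℕ}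

/-- `G(ε|x;θ)`: the set of pure strategy Nash equilibria at state `(x, ε)` and parameter `θ`. -/
def equilibria (Γ : DiscreteGame ι Act X E d) (x : X) (θ : EuclideanSpace ℝ (Fin d))
    (ε : ∀ i, E i) : Set (∀ i, Act i) :=
  {y | ∀ (i : ι) (a : Act i),
    Γ.payoff i (Function.update y i a) x (ε i) θ ≤ Γ.payoff i y x (ε i) θ}

/-- `G⁻¹(A|x;θ)`: the latent vectors at which some outcome in `A` is an equilibrium. -/
def support (Γ : DiscreteGame ι Act X E d) (x : X) (θ : EuclideanSpace ℝ (Fin d))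
    (A : Finset (∀ i, Act i)) : Set (∀ i, E i) :=
  {ε | (Γ.equilibria x θ ε ∩ (A : Set (∀ i, Act i))).Nonempty}

/-- The generalized likelihood `ℒ(A|x;θ)` (Choquet capacity). -/
noncomputable def genLikelihood (Γ : DiscreteGame ι Act X E d) (x : X)
    (θ : EuclideanSpace ℝ (Fin d)) (A : Finset (∀ i, Act i)) : ℝ :=
  (Γ.shockLaw x θ).real (Γ.support x θ A)

/-- An equilibrium selection rule at `(x, θ)`: a measurable choice, for each latent vector, of a
probability vector over outcomes, which almost surely charges only equilibria. -/
structure IsSelectionRule (Γ : DiscreteGame ι Act X E d) (x : X)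
    (θ : EuclideanSpace ℝ (Fin d)) (σ : (∀ i, E i) → (∀ i, Act i) → ℝ) : Prop where
  measurable : ∀ y, Measurable fun ε => σ ε y
  mem_stdSimplex : ∀ ε, σ ε ∈ stdSimplex ℝ (∀ i, Act i)
  mem_equilibria : ∀ᵐ ε ∂(Γ.shockLaw x θ), ∀ y, σ ε y ≠ 0 → y ∈ Γ.equilibria x θ ε

/-- The sharp identified set: the parameters at which, for every covariate value, the conditional
choice probabilities `φ(·|x)` are generated by some equilibrium selection rule. -/
def sharpIdentifiedSet (Γ : DiscreteGame ι Act X E d) (φ : X → (∀ i, Act i) → ℝ) :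
    Set (EuclideanSpace ℝ (Fin d)) :=
  {θ ∈ Γ.paramSpace | ∀ x, ∃ σ, Γ.IsSelectionRule x θ σ ∧
    ∀ y, φ x y = ∫ ε, σ ε y ∂(Γ.shockLaw x θ)}

/-- The class of outcome sets that split into two nonempty disjoint parts whose supporting sets
of latent vectors are disjoint. -/
def splittable (Γ : DiscreteGame ι Act X E d) (x : X) (θ : EuclideanSpace ℝ (Fin d)) :
    Set (Finset (∀ i, Act i)) :=
  {A | ∃ B₁ B₂ : Finset (∀ i, Act i), B₁.Nonempty ∧ B₂.Nonempty ∧ Disjoint B₁ B₂ ∧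
    A = B₁ ∪ B₂ ∧ Γ.support x θ B₁ ∩ Γ.support x θ B₂ = ∅}

/-- The class `𝒜*` of outcome sets that do not split. -/
def unsplittable (Γ : DiscreteGame ι Act X E d) (x : X) (θ : EuclideanSpace ℝ (Fin d)) :
    Set (Finset (∀ i, Act i)) :=
  (Γ.splittable x θ)ᶜ

end

end DiscreteGame

/-!
The identification result rests on a finite-outcome form of Artstein's theorem
(`exists_measurable_selection_of_forall_sum_le`): a probability vector `p` is the law of a randomized
measurable selection of a random set `G` as soon as `p(A) ≤ ν(G ∩ A ≠ ∅)` for every `A`.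

A pure selector `s` picks a point of every nonempty set. There are finitely many of them, so the
convex hull of the laws of `s ∘ G` is compact, and its elements are the laws of the randomized
selections that mix pure selectors. If `p` were outside this hull, a linear functional `f` would
take a strictly larger value at `p` than on the hull. Let `s` be the selector that maximizes `f` on
every set. For every upper level set `A` of `f`, the point `s(G)` lies in `A` exactly when `G` meets
`A`, so the law `q` of `s(G)` satisfies `q(A) = ν(G ∩ A ≠ ∅) ≥ p(A)`. Summing over the level sets of
`f` (`sum_mul_nonneg_of_levels`) gives `f(q) ≥ f(p)`, a contradiction.

Conversely, every selection rule satisfies all the inequalities by integration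
(`DiscreteGame.IsSelectionRule.sum_integral_le_genLikelihood`). Finally, if `A` splits into `B₁` and `B₂`, the likelihood is
additive on the pair, so the inequality for `A` is the sum of those for `B₁` and `B₂`; induction on
the size of `A` shows that the unsplittable sets suffice
(`DiscreteGame.sum_le_genLikelihood_of_unsplittable`).
-/

/-! ### Sums over upper level sets -/

/-- The case `f ≥ 0` of `sum_mul_nonneg_of_levels`: peel off the lowest positive layer of `f`. -/
theorem sum_mul_nonneg_of_levels_of_nonneg {Y : Type*} [Fintype Y] (w : Y → ℝ)
    (f : Y → ℝ) (hf : ∀ y, 0 ≤ f y)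
    (hw : ∀ t : ℝ, 0 ≤ ∑ y with t < f y, w y) : 0 ≤ ∑ y, w y * f y := by
  classical
  induction hn : (Finset.univ.filter fun y => 0 < f y).card using Nat.strong_induction_on
    generalizing f with
  | _ n ih =>
  rcases (Finset.univ.filter fun y => 0 < f y).eq_empty_or_nonempty with h0 | hne
  · refine le_of_eq (Finset.sum_eq_zero fun y _ => ?_).symm
    have hy : y ∉ Finset.univ.filter fun y => 0 < f y := by simp [h0]
    have : f y = 0 := le_antisymm (by simpa using hy) (hf y)
    simp [this]
  · obtain ⟨y₀, hy₀, hmin⟩ := Finset.exists_min_image _ f hne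
    have hpos : 0 < f y₀ := by simpa using hy₀
    have hmin' : ∀ y, 0 < f y → f y₀ ≤ f y := fun y hy => hmin y (by simpa using hy)
    have hlevel : ∀ t : ℝ, 0 ≤ t → ∀ y, t < max (f y - f y₀) 0 ↔ t + f y₀ < f y := by
      intro t ht y
      rw [lt_max_iff]
      constructor
      · rintro (h | h) <;> linarith
      · intro h; left; linarith
    have key : 0 ≤ ∑ y, w y * max (f y - f y₀) 0 := by
      refine ih _ ?_ (fun y => max (f y - f y₀) 0) (fun y => le_max_right _ _) ?_ rfl
      · rw [← hn]
        refine Finset.card_lt_card (Finset.ssubset_iff_subset_ne.2 ⟨fun y hy => ?_, fun h => ?_⟩)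
        · have := (hlevel 0 le_rfl y).1 (by simpa using hy)
          simpa using (by linarith : 0 < f y)
        · rw [← h] at hy₀
          simp at hy₀
      · intro t
        rcases le_or_gt 0 t with ht | ht
        · simpa only [hlevel t ht] using hw (t + f y₀)
        · -- Below zero every level set is everything, for the truncated function and for `f`.
          have h1 : ∀ y, t < max (f y - f y₀) 0 := fun y => lt_max_of_lt_right ht
          have h2 : ∀ y, t < f y := fun y => ht.trans_le (hf y)
          have := hw t
          simpa only [h1, h2] using this
    have hsplit : ∑ y, w y * f y
        = f y₀ * (∑ y with 0 < f y, w y) + ∑ y, w y * max (f y - f y₀) 0 := by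
      rw [Finset.sum_filter, Finset.mul_sum, ← Finset.sum_add_distrib]
      refine Finset.sum_congr rfl fun y _ => ?_
      by_cases hy : 0 < f y
      · rw [if_pos hy, max_eq_left (by linarith [hmin' y hy])]; ring
      · have : f y = 0 := le_antisymm (not_lt.1 hy) (hf y)
        simp [this, hpos.le]
    rw [hsplit]
    exact add_nonneg (mul_nonneg hpos.le (hw 0)) key

/-- A weight of total mass zero that is nonnegative on every upper level set of `f` integrates `f`
to a nonnegative number. -/
theorem sum_mul_nonneg_of_levels {Y : Type*} [Fintype Y] (w : Y → ℝ) (hw0 : ∑ y, w y = 0)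
    (f : Y → ℝ) (hw : ∀ t : ℝ, 0 ≤ ∑ y with t < f y, w y) : 0 ≤ ∑ y, w y * f y := by
  have h := sum_mul_nonneg_of_levels_of_nonneg w (fun y => f y + ∑ z, |f z|)
    (fun y => by
      have h1 := Finset.single_le_sum (f := fun z => |f z|) (fun z _ => abs_nonneg _)
        (Finset.mem_univ y)
      have h2 := neg_abs_le (f y)
      linarith)
    (fun t => by simpa only [sub_lt_iff_lt_add] using hw (t - ∑ z, |f z|))
  simpa [mul_add, Finset.sum_add_distrib, ← Finset.sum_mul, hw0] using h

/-! ### Selections of a random finite set -/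

/-- The pure selectors on `Y`: the maps that send every nonempty subset of `Y` to one of its
points. The value at the empty set is arbitrary. -/
abbrev PureSelector (Y : Type*) : Type _ := {s : Set Y → Y // ∀ T, T.Nonempty → s T ∈ T}

/-- A function on a finite type has a pure selector that maximizes it on every nonempty set. -/
theorem exists_pureSelector_forall_le {Y : Type*} [Finite Y] [Nonempty Y] (f : Y → ℝ) :
    ∃ s : PureSelector Y, ∀ T : Set Y, ∀ y ∈ T, f y ≤ f (s.1 T) := by
  have h : ∀ T : Set Y, ∃ z, T.Nonempty → z ∈ T ∧ ∀ y ∈ T, f y ≤ f z := by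
    intro T
    rcases T.eq_empty_or_nonempty with rfl | hT
    · exact ⟨Classical.arbitrary Y, fun h => absurd h (by simp)⟩
    · obtain ⟨z, hz, hmax⟩ := Set.exists_max_image T f T.toFinite hT
      exact ⟨z, fun _ => ⟨hz, hmax⟩⟩
  choose s hs using h
  exact ⟨⟨s, fun T hT => (hs T hT).1⟩, fun T y hy => (hs T ⟨y, hy⟩).2 y hy⟩

section

variable {Ω Y : Type*} [MeasurableSpace Ω]

theorem measurableSet_setOf_of_finite [Finite Y] (G : Ω → Set Y) (hG : ∀ y, MeasurableSet {ω | y ∈ G ω})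
    (P : Set Y → Prop) : MeasurableSet {ω | P (G ω)} := by
  have hm : Measurable G := measurable_set_iff.2 fun y => measurableSet_setOfPred.1 (hG y)
  exact hm (Set.toFinite {T | P T}).measurableSet

/-- The law of a measurable function with values in a finite set gives `A` the probability of
landing in `A`. -/
theorem sum_real_fiber_eq (ν : Measure Ω) [IsFiniteMeasure ν] (g : Ω → Y)
    (hg : ∀ y, MeasurableSet {ω | g ω = y}) (A : Finset Y) :
    ∑ y ∈ A, ν.real {ω | g ω = y} = ν.real {ω | g ω ∈ A} := by
  rw [← measureReal_biUnion_finset]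
  · congr 1
    ext ω
    simp
  · intro y _ z _ hyz
    exact Set.disjoint_left.2 fun ω h1 h2 => hyz (h1.symm.trans h2)
  · exact fun y _ => hg y

variable [Fintype Y]

/-- The Artstein inequalities put `p` in the convex hull of the laws of the pure selections. -/
theorem mem_convexHull_range_law (ν : Measure Ω) [IsProbabilityMeasure ν] (G : Ω → Set Y)
    (hG : ∀ y, MeasurableSet {ω | y ∈ G ω}) (p : Y → ℝ) (hp : p ∈ stdSimplex ℝ Y)
    (h : ∀ A : Finset Y, ∑ y ∈ A, p y ≤ ν.real {ω | (G ω ∩ (A : Set Y)).Nonempty}) :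
    p ∈ convexHull ℝ
      (Set.range fun (s : PureSelector Y) (y : Y) => ν.real {ω | s.1 (G ω) = y}) := by
  classical
  have hY : Nonempty Y := by
    by_contra hY
    rw [not_nonempty_iff] at hY
    simpa using hp.2
  by_contra hnot
  obtain ⟨f, u, hfu, hup⟩ := geometric_hahn_banach_closed_point
    (convex_convexHull ℝ _) ((Set.finite_range _).isClosed_convexHull ℝ) hnot
  set c : Y → ℝ := fun y => f fun z => if y = z then 1 else 0
  have hfc : ∀ v : Y → ℝ, f v = ∑ y, v y * c y := fun v =>
    LinearMap.pi_apply_eq_sum_univ (f : (Y → ℝ) →ₗ[ℝ] ℝ) v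
  obtain ⟨s, hs⟩ := exists_pureSelector_forall_le c
  have hmeas : ∀ y, MeasurableSet {ω | s.1 (G ω) = y} := fun y =>
    measurableSet_setOf_of_finite G hG fun T => s.1 T = y
  have hlaw := sum_real_fiber_eq ν (fun ω => s.1 (G ω)) hmeas
  have hq := hfu _ (subset_convexHull ℝ _ ⟨s, rfl⟩)
  have hnonneg := sum_mul_nonneg_of_levels (fun y => ν.real {ω | s.1 (G ω) = y} - p y)
    (by rw [Finset.sum_sub_distrib, hlaw, hp.2]; simp) c
    (fun t => by
      rw [Finset.sum_sub_distrib, hlaw, sub_nonneg]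
      refine (h _).trans (measureReal_mono ?_)
      rintro ω ⟨y, hy, hyt⟩
      have hyt' : t < c y := by simpa using hyt
      simpa using hyt'.trans_le (hs _ y hy))
  simp only [sub_mul, Finset.sum_sub_distrib] at hnonneg
  rw [hfc] at hq hup
  linarith

/-- **Artstein's theorem** for a random subset `G` of a finite set: if a probability vector `p`
satisfies `p(A) ≤ ν(G ∩ A ≠ ∅)` for all `A`, then it is the law of a randomized measurable selection
of `G`. -/
theorem exists_measurable_selection_of_forall_sum_le (ν : Measure Ω) [IsProbabilityMeasure ν]
    (G : Ω → Set Y) (hG : ∀ y, MeasurableSet {ω | y ∈ G ω}) (p : Y → ℝ) (hp : p ∈ stdSimplex ℝ Y)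
    (h : ∀ A : Finset Y, ∑ y ∈ A, p y ≤ ν.real {ω | (G ω ∩ (A : Set Y)).Nonempty}) :
    ∃ σ : Ω → Y → ℝ, (∀ y, Measurable fun ω => σ ω y) ∧ (∀ ω, σ ω ∈ stdSimplex ℝ Y) ∧
      (∀ᵐ ω ∂ν, ∀ y, σ ω y ≠ 0 → y ∈ G ω) ∧ ∀ y, p y = ∫ ω, σ ω y ∂ν := by
  classical
  obtain ⟨κ, _, a, z, ha0, ha1, hz, hsum⟩ :=
    mem_convexHull_iff_exists_fintype.1 (mem_convexHull_range_law ν G hG p hp h)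
  choose s hs using hz
  have hmeas : ∀ k y, MeasurableSet {ω | (s k).1 (G ω) = y} := fun k y =>
    measurableSet_setOf_of_finite G hG fun T => (s k).1 T = y
  -- Draw the pure selector `s k` with probability `a k`, independently of `ω`.
  refine ⟨fun ω y => ∑ k, a k * {ω | (s k).1 (G ω) = y}.indicator (fun _ => (1 : ℝ)) ω,
    fun y => ?_, fun ω => ⟨fun y => ?_, ?_⟩, ?_, fun y => ?_⟩
  · exact Finset.measurable_sum _ fun k _ =>
      (measurable_const.indicator (hmeas k y)).const_mul _
  · exact Finset.sum_nonneg fun k _ =>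
      mul_nonneg (ha0 k) (Set.indicator_nonneg (fun _ _ => zero_le_one) _)
  · rw [Finset.sum_comm]
    simpa [Set.indicator_apply] using ha1
  · -- The inequality for the whole set says that `G` is almost surely nonempty.
    have hne : ∀ᵐ ω ∂ν, (G ω).Nonempty := by
      have hm : MeasurableSet {ω | (G ω).Nonempty} :=
        measurableSet_setOf_of_finite G hG Set.Nonempty
      have h1 : 1 ≤ ν.real {ω | (G ω).Nonempty} := by
        simpa [hp.2] using h Finset.univ
      refine (prob_compl_eq_zero_iff hm).2 ?_
      rw [← ofReal_measureReal, le_antisymm measureReal_le_one h1, ENNReal.ofReal_one]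
    filter_upwards [hne] with ω hω y hy
    obtain ⟨k, -, hk⟩ := Finset.exists_ne_zero_of_sum_ne_zero hy
    have hk' : (s k).1 (G ω) = y := by
      by_contra hcon
      simp [hcon] at hk
    exact hk' ▸ (s k).2 _ hω
  · rw [integral_finsetSum _ fun k _ =>
      ((integrable_const (1 : ℝ)).indicator (hmeas k y)).const_mul _]
    rw [← hsum, Finset.sum_apply]
    refine Finset.sum_congr rfl fun k _ => ?_
    rw [integral_const_mul, integral_indicator_const _ (hmeas k y), ← hs k]
    simp

end

namespace DiscreteGame

/-! ### The likelihood of a game -/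

section

variable {ι : Type*} {Act : ι → Type*} [DecidableEq ι]
  {X : Type*} {E : ι → Type*} [∀ i, MeasurableSpace (E i)] {d : ℕ}
  (Γ : DiscreteGame ι Act X E d) (x : X) (θ : EuclideanSpace ℝ (Fin d))

theorem measurableSet_support (hG : ∀ y, MeasurableSet {ε | y ∈ Γ.equilibria x θ ε})
    (A : Finset (∀ i, Act i)) : MeasurableSet (Γ.support x θ A) := by
  have : Γ.support x θ A = ⋃ y ∈ A, {ε | y ∈ Γ.equilibria x θ ε} := by
    ext ε
    simp [support, Set.Nonempty, and_comm]
  rw [this]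
  exact A.measurableSet_biUnion fun y _ => hG y

variable [Fintype ι]

theorem genLikelihood_union_of_disjoint [∀ i, DecidableEq (Act i)]
    [IsFiniteMeasure (Γ.shockLaw x θ)]
    (hG : ∀ y, MeasurableSet {ε | y ∈ Γ.equilibria x θ ε}) {B₁ B₂ : Finset (∀ i, Act i)}
    (h : Γ.support x θ B₁ ∩ Γ.support x θ B₂ = ∅) :
    Γ.genLikelihood x θ (B₁ ∪ B₂) = Γ.genLikelihood x θ B₁ + Γ.genLikelihood x θ B₂ := by
  have hU : Γ.support x θ (B₁ ∪ B₂) = Γ.support x θ B₁ ∪ Γ.support x θ B₂ := by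
    ext ε
    simp [support, Set.inter_union_distrib_left, Set.union_nonempty]
  rw [genLikelihood, hU, measureReal_union (Set.disjoint_iff_inter_eq_empty.2 h)
    (Γ.measurableSet_support x θ hG B₂)]
  rfl

/-- The inequality for a split set is the sum of the inequalities for its two parts, which are
strictly smaller. -/
theorem sum_le_genLikelihood_of_unsplittable [∀ i, DecidableEq (Act i)]
    [IsFiniteMeasure (Γ.shockLaw x θ)]
    (hG : ∀ y, MeasurableSet {ε | y ∈ Γ.equilibria x θ ε}) (p : (∀ i, Act i) → ℝ)
    (h : ∀ A ∈ Γ.unsplittable x θ, ∑ y ∈ A, p y ≤ Γ.genLikelihood x θ A)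
    (A : Finset (∀ i, Act i)) : ∑ y ∈ A, p y ≤ Γ.genLikelihood x θ A := by
  induction A using Finset.strongInduction with
  | H A ih =>
  by_cases hA : A ∈ Γ.splittable x θ
  · obtain ⟨B₁, B₂, ⟨b₁, hb₁⟩, ⟨b₂, hb₂⟩, hdisj, rfl, hsupp⟩ := hA
    rw [Finset.sum_union hdisj, Γ.genLikelihood_union_of_disjoint x θ hG hsupp]
    refine add_le_add (ih _ ?_) (ih _ ?_)
    · exact Finset.ssubset_iff_subset_ne.2 ⟨Finset.subset_union_left, fun h =>
        Finset.disjoint_left.1 hdisj (h ▸ Finset.mem_union_right _ hb₂) hb₂⟩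
    · exact Finset.ssubset_iff_subset_ne.2 ⟨Finset.subset_union_right, fun h =>
        Finset.disjoint_left.1 hdisj hb₁ (h ▸ Finset.mem_union_left _ hb₁)⟩
  · exact h A hA

variable [∀ i, Fintype (Act i)]

theorem isCoreDetermining_unsplittable [∀ i, DecidableEq (Act i)]
    [IsFiniteMeasure (Γ.shockLaw x θ)]
    (hG : ∀ y, MeasurableSet {ε | y ∈ Γ.equilibria x θ ε}) :
    IsCoreDetermining (Γ.genLikelihood x θ) (Γ.unsplittable x θ) :=
  fun p _ h => Γ.sum_le_genLikelihood_of_unsplittable x θ hG p h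

variable {Γ x θ}

/-- The mass that a selection rule gives to `A` is at most one, and it vanishes almost surely where
no equilibrium lies in `A`; integrating gives the likelihood bound. -/
theorem IsSelectionRule.sum_integral_le_genLikelihood [IsFiniteMeasure (Γ.shockLaw x θ)]
    (hG : ∀ y, MeasurableSet {ε | y ∈ Γ.equilibria x θ ε})
    {σ : (∀ i, E i) → (∀ i, Act i) → ℝ} (hσ : Γ.IsSelectionRule x θ σ)
    (A : Finset (∀ i, Act i)) :
    ∑ y ∈ A, ∫ ε, σ ε y ∂(Γ.shockLaw x θ) ≤ Γ.genLikelihood x θ A := by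
  have hint : ∀ y, Integrable (fun ε => σ ε y) (Γ.shockLaw x θ) := fun y => by
    refine Integrable.of_bound (hσ.measurable y).aestronglyMeasurable 1 (.of_forall fun ε => ?_)
    have h := mem_Icc_of_mem_stdSimplex (hσ.mem_stdSimplex ε) y
    rw [Real.norm_of_nonneg h.1]
    exact h.2
  have hA := Γ.measurableSet_support x θ hG A
  rw [← integral_finsetSum _ fun y _ => hint y]
  have hL : Γ.genLikelihood x θ A
      = ∫ ε, (Γ.support x θ A).indicator (fun _ => (1 : ℝ)) ε ∂(Γ.shockLaw x θ) := by
    rw [integral_indicator_const _ hA]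
    simp [genLikelihood]
  rw [hL]
  refine integral_mono_ae (integrable_finsetSum _ fun y _ => hint y)
    ((integrable_const _).indicator hA) ?_
  filter_upwards [hσ.mem_equilibria] with ε hε
  by_cases hmem : ε ∈ Γ.support x θ A
  · rw [Set.indicator_of_mem hmem, ← (hσ.mem_stdSimplex ε).2]
    exact Finset.sum_le_univ_sum_of_nonneg (hσ.mem_stdSimplex ε).1
  · rw [Set.indicator_of_notMem hmem]
    refine (Finset.sum_eq_zero fun y hy => ?_).le
    by_contra hne
    exact hmem ⟨y, hε y hne, hy⟩

/-- The inequalities for all outcome sets characterize the probability vectors that some selection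
rule generates. -/
theorem exists_isSelectionRule_iff [IsProbabilityMeasure (Γ.shockLaw x θ)]
    (hG : ∀ y, MeasurableSet {ε | y ∈ Γ.equilibria x θ ε})
    {p : (∀ i, Act i) → ℝ} (hp : p ∈ stdSimplex ℝ (∀ i, Act i)) :
    (∃ σ, Γ.IsSelectionRule x θ σ ∧ ∀ y, p y = ∫ ε, σ ε y ∂(Γ.shockLaw x θ)) ↔
      ∀ A : Finset (∀ i, Act i), ∑ y ∈ A, p y ≤ Γ.genLikelihood x θ A := by
  constructor
  · rintro ⟨σ, hσ, hpσ⟩ A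
    simpa only [hpσ] using hσ.sum_integral_le_genLikelihood hG A
  · intro h
    obtain ⟨σ, h₁, h₂, h₃, h₄⟩ :=
      exists_measurable_selection_of_forall_sum_le (Γ.shockLaw x θ) (Γ.equilibria x θ) hG p hp h
    exact ⟨σ, ⟨h₁, h₂, h₃⟩, h₄⟩

end

end DiscreteGame

theorem mainTheorem6 {ι : Type*} [Fintype ι] [DecidableEq ι]
    {Act : ι → Type*} [∀ i, Fintype (Act i)] [∀ i, DecidableEq (Act i)]
    {X : Type*} [Finite X] {E : ι → Type*} [∀ i, MeasurableSpace (E i)] {d : ℕ}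
    (Γ : DiscreteGame ι Act X E d)
    (hν : ∀ x, ∀ θ ∈ Γ.paramSpace, IsProbabilityMeasure (Γ.shockLaw x θ))
    (hG : ∀ x, ∀ θ ∈ Γ.paramSpace, ∀ y, MeasurableSet {ε | y ∈ Γ.equilibria x θ ε})
    (φ : X → (∀ i, Act i) → ℝ) (hφ : ∀ x, φ x ∈ stdSimplex ℝ (∀ i, Act i)) :
    Γ.sharpIdentifiedSet φ =
        {θ ∈ Γ.paramSpace | ∀ x, ∀ A ∈ Γ.unsplittable x θ,
          ∑ y ∈ A, φ x y ≤ Γ.genLikelihood x θ A} ∧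
      ∀ x, ∀ θ ∈ Γ.paramSpace,
        IsCoreDetermining (Γ.genLikelihood x θ) (Γ.unsplittable x θ) := by
  refine ⟨?_, fun x θ hθ => ?_⟩
  · ext θ
    refine and_congr_right fun hθ => forall_congr' fun x => ?_
    have := hν x θ hθ
    rw [DiscreteGame.exists_isSelectionRule_iff (hG x θ hθ) (hφ x)]
    exact ⟨fun h A _ => h A,
      fun h => Γ.isCoreDetermining_unsplittable x θ (hG x θ hθ) (φ x) (hφ x) h⟩
  · have := hν x θ hθ
    exact Γ.isCoreDetermining_unsplittable x θ (hG x θ hθ)
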